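/- Consider best-first branch-and-bound for maximum independent set on graphs with vertices $v_1,\dots,v_n$. A node of level $i$ of the search tree is an independent subset $S$ of $\{v_1,\dots,v_i\}$, and its potential is $|S|+n-i$. The search starts with the root (level $0$, $S=\emptyset$) as the only open node. In each step it handles an open node of largest potential, ties being broken arbitrarily: if this node has level $n$ the search stops; otherwise the node is replaced by its feasible children, which have level $i+1$ and partial solution $S$ or, if that set is independent, $S\cup\{v_{i+1}\}$. The running time is the number of nodes handled (for the worst tie-breaking), and $\mathbb T(n,p)$ is its expectation on the binomial random graph $\mathcal G(n,p)$. For $k>0$ let $$\gamma(k)=\sup_{0<x\le 1}\exp\Bigl(\min\bigl\{\psi_k(x),\tfrac12\mu_k(1/x)\bigr\}\Bigr),\qquad \psi_k(x)=-x\ln x-(1-x)\ln(1-x)-\tfrac{k x^2}{2},$$ where $0\ln 0=0$, and $\mu_k(\lambda)=2\ln 2+\lambda-(k+1)+(\lambda-1)\ln\frac{k}{\lambda-1}$ if $\lambda>k+1$, $\mu_k(\lambda)=2\ln 2$ if $1\le\lambda\le k+1$. Theorem. (i) There are constants $C,d$ such that $\mathbb T(n,k/n)\le C\,n^{d}\,\gamma(k)^n$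 for all real $k>0$ and all integers $n\ge 1$ with $k\le n$. (ii) There is a constant $C$ such that $\mathbb T(n,k/n)\le C\cdot 1.867^n$ for all such $k$ and $n$. (iii) $\gamma(k)\le\gamma(0.47)+0.001$ for all $k>0$, $\gamma(0.47)\le 1.867$, and $\gamma(k)\le 1.867$ for all $k>0$. (iv) $\gamma(k)\to 1$ as $k\to 0^+$ and as $k\to\infty$. -/

import Mathlib

namespace BranchAndBound

/-- A node of the search tree for the vertices `v_0, …, v_{n-1}`: the vertices `v_j` with
`j < level` have been decided, and those in `chosen` are the ones that were taken. -/
@[ext]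
structure Node (n : ℕ) where
  level : ℕ
  chosen : Finset (Fin n)

/-- The potential (evaluation) of a node: the size of the partial solution plus the number of
vertices that are still undecided. -/
def Node.potential {n : ℕ} (t : Node n) : ℕ := t.chosen.card + (n - t.level)

/-- The root: nothing has been decided. -/
def root (n : ℕ) : Node n := ⟨0, ∅⟩

open Classical in
/-- The feasible children of a node of level less than `n`: the next vertex is either rejected, or
taken provided that the partial solution remains an independent set of `G`.
A node of level `n` (a global solution) has no children. -/
noncomputable def children {n : ℕ} (G : SimpleGraph (Fin n)) (t : Node n) : Finset (Node n) :=
  if h : t.level < n then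
    if G.IsIndepSet (↑(insert ⟨t.level, h⟩ t.chosen) : Set (Fin n)) then
      {⟨t.level + 1, t.chosen⟩, ⟨t.level + 1, insert ⟨t.level, h⟩ t.chosen⟩}
    else {⟨t.level + 1, t.chosen⟩}
  else ∅

/-- `t` is a node of largest potential among the open nodes `F`. -/
def IsBest {n : ℕ} (F : Finset (Node n)) (t : Node n) : Prop :=
  t ∈ F ∧ ∀ t' ∈ F, t'.potential ≤ t.potential

open Classical in
/-- `Run G F c`: from the set `F` of open nodes, the best-first branch-and-bound search for a
maximum independent set of `G` can stop after having handled exactly `c` nodes. In each step an open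
node of largest potential is handled (ties are broken arbitrarily). If it is a global solution, the
search stops, all the other open nodes being pruned; otherwise it is replaced by its feasible
children. -/
inductive Run {n : ℕ} (G : SimpleGraph (Fin n)) : Finset (Node n) → ℕ → Prop
  | finish (F : Finset (Node n)) (t : Node n) (best : IsBest F t) (leaf : t.level = n) : Run G F 1
  | expand (F : Finset (Node n)) (t : Node n) (c : ℕ) (best : IsBest F t) (inner : t.level < n)
      (rest : Run G (F.erase t ∪ children G t) c) : Run G F (c + 1)

theorem sum_children_lt {n : ℕ} (G : SimpleGraph (Fin n)) (t : Node n) (h : t.level < n) :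
    ∑ s ∈ children G t, 3 ^ (n - s.level) < 3 ^ (n - t.level) := by
  classical
  have key : 3 ^ (n - t.level) = 3 * 3 ^ (n - (t.level + 1)) := by
    rw [← pow_succ']; congr 1; omega
  have hp : 0 < 3 ^ (n - (t.level + 1)) := by positivity
  unfold children
  rw [dif_pos h]
  split_ifs
  · refine lt_of_le_of_lt (Finset.sum_le_card_nsmul _ _ (3 ^ (n - (t.level + 1))) ?_) ?_
    · intro s hs
      simp only [Finset.mem_insert, Finset.mem_singleton] at hs
      rcases hs with rfl | rfl <;> exact le_rfl
    · have := Finset.card_le_two (a := (⟨t.level + 1, t.chosen⟩ : Node n))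
        (b := ⟨t.level + 1, insert ⟨t.level, h⟩ t.chosen⟩)
      rw [smul_eq_mul, key]
      nlinarith
  · simp only [Finset.sum_singleton]
    omega

/-- The search always stops, whatever the graph is. -/
theorem exists_run {n : ℕ} (G : SimpleGraph (Fin n)) : ∃ c, Run G {root n} c := by
  classical
  have main : ∀ N : ℕ, ∀ F : Finset (Node n), F.Nonempty → (∀ t ∈ F, t.level ≤ n) →
      ∑ s ∈ F, 3 ^ (n - s.level) ≤ N → ∃ c, Run G F c := by
    intro N
    induction N with
    | zero =>
      intro F ⟨t, ht⟩ _ hN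
      have := Finset.single_le_sum (f := fun s : Node n => 3 ^ (n - s.level))
        (fun _ _ => Nat.zero_le _) ht
      have : 0 < 3 ^ (n - t.level) := by positivity
      omega
    | succ N ih =>
      intro F hF hlev hN
      obtain ⟨t, ht, hbest⟩ := F.exists_max_image Node.potential hF
      rcases (hlev t ht).eq_or_lt with hl | hl
      · exact ⟨1, Run.finish F t ⟨ht, hbest⟩ hl⟩
      · have hmem : ∀ s ∈ children G t, s.level = t.level + 1 := by
          intro s hs
          unfold children at hs
          rw [dif_pos hl] at hs
          split_ifs at hs
          · simp only [Finset.mem_insert, Finset.mem_singleton] at hs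
            rcases hs with rfl | rfl <;> rfl
          · simp only [Finset.mem_singleton] at hs
            rw [hs]
        have hne : (children G t).Nonempty := by
          unfold children
          rw [dif_pos hl]
          split_ifs <;> simp
        obtain ⟨c, hc⟩ := ih (F.erase t ∪ children G t) (hne.mono Finset.subset_union_right)
          (by
            intro s hs
            rcases Finset.mem_union.1 hs with hs | hs
            · exact hlev s (Finset.mem_of_mem_erase hs)
            · rw [hmem s hs]; omega)
          (by
            have h1 := Finset.sum_union_inter (s₁ := F.erase t) (s₂ := children G t)
              (f := fun s : Node n => 3 ^ (n - s.level))
            have h2 := Finset.add_sum_erase F (fun s : Node n => 3 ^ (n - s.level)) ht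
            have h3 := sum_children_lt G t hl
            omega)
        exact ⟨c + 1, Run.expand F t c ⟨ht, hbest⟩ hl hc⟩
  exact main _ {root n} (Finset.singleton_nonempty _) (by simp [root]) le_rfl

/-- The running time on `G`: the number of nodes of the search tree that are handled when the
search is started at the root, for the worst way of breaking ties. -/
noncomputable def runningTime {n : ℕ} (G : SimpleGraph (Fin n)) : ENat :=
  ⨆ (c : ℕ) (_ : Run G {root n} c), (c : ENat)

/-- The average running time on a binomial random graph with parameters `(n, p)`. -/
noncomputable def averageRunningTime (n : ℕ) (p : unitInterval) : ENNReal :=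
  ∫⁻ G, (runningTime G : ENNReal) ∂(SimpleGraph.binomialRandom (Fin n) p)

/-- The exponent `ψ` coming from the number of independent sets, at relative potential `x`. -/
noncomputable def psi (k x : ℝ) : ℝ :=
  - x * Real.log x - (1 - x) * Real.log (1 - x) - k * x ^ 2 / 2

/-- The exponent `μ` coming from the tail of the number of edges, as a function of `l = 1 / x` for
the relative potential `x`. For `l ≤ k + 1` the tail event is not a large deviation and
only the trivial bound is left. -/
noncomputable def mu (k l : ℝ) : ℝ :=
  if k + 1 < l then 2 * Real.log 2 + l - (k + 1) + (l - 1) * Real.log (k / (l - 1))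
  else 2 * Real.log 2

/-- The base `γ(k) = sup_{0 < x ≤ 1} exp (min (ψ(x), μ(1/x) / 2))` of the exponential bound. -/
noncomputable def gamma (k : ℝ) : ℝ :=
  sSup ((fun x : ℝ => Real.exp (min (psi k x) (mu k (1 / x) / 2))) '' Set.Ioc 0 1)

end BranchAndBound

/-! Whatever the tie-breaking, some open node is always an ancestor of a given maximum independent
set, so every handled node has potential at least the independence number α(G) (`Run.le_card`). The
running time is therefore at most the number of pairs (i, S) with S an independent subset of the
first i vertices and α(G) ≤ |S| + n - i (`runningTime_le`).

For |S| = s and relative potential x = (s + n - i)/n, the probability of both events is at most the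
smaller of the two. Independence of S costs (1 - p)^(s choose 2); together with the count C(i, s)
this gives the exponent ψ (`choose_mul_exp_le`). A small α forces many edges by Turán's theorem, and
Chernoff's bound makes that unlikely; together with the trivial count 2^n this gives the exponent
μ/2 (`binomialRandom_real_indepBound_le`). Each pair (i, s) thus contributes at most 2nγ(k)^n
(`choose_mul_min_le`), and there are at most (n + 1)² pairs.

The numerical bound on γ bounds the minimum of ψ and μ/2 by the average with weights 3/4 and 1/4. A
tangent to the logarithm then eliminates k and leaves a polynomial inequality in x (`min_le`).
Evaluating at one point for k = 0.47 shows that the bound is nearly attained. -/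

namespace BranchAndBound

/-! ### Best-first search and the nodes it handles -/

variable {n : ℕ}

/-- The elements of `S` that come before position `i`. -/
def truncate (i : ℕ) (S : Finset (Fin n)) : Finset (Fin n) := S.filter fun j => (j : ℕ) < i

/-- `t` is an ancestor of `u` (or `u` itself) in the search tree. -/
def Node.IsAncestor (t u : Node n) : Prop :=
  t.level ≤ u.level ∧ t.chosen = truncate t.level u.chosen

theorem mem_truncate {i : ℕ} {S : Finset (Fin n)} {j : Fin n} :
    j ∈ truncate i S ↔ j ∈ S ∧ (j : ℕ) < i := by
  simp [truncate]

theorem truncate_truncate {i j : ℕ} (h : i ≤ j) (S : Finset (Fin n)) :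
    truncate i (truncate j S) = truncate i S := by
  ext a
  simp only [mem_truncate]
  grind

theorem Node.IsAncestor.trans {t u v : Node n} (h : t.IsAncestor u) (h' : u.IsAncestor v) :
    t.IsAncestor v :=
  ⟨h.1.trans h'.1, by rw [h.2, h'.2, truncate_truncate h.1]⟩

/-- `t` is a node of the search tree of `G`. -/
def IsTreeNode (G : SimpleGraph (Fin n)) (t : Node n) : Prop :=
  t.level ≤ n ∧ (∀ j ∈ t.chosen, (j : ℕ) < t.level) ∧ G.IsIndepSet (t.chosen : Set (Fin n))

theorem IsTreeNode.truncate_eq {G : SimpleGraph (Fin n)} {t : Node n} (ht : IsTreeNode G t) {i : ℕ}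
    (hi : t.level ≤ i) : truncate i t.chosen = t.chosen := by
  ext a
  simp only [mem_truncate]
  have := ht.2.1 a
  grind

theorem mem_children {G : SimpleGraph (Fin n)} {t c : Node n} (h : t.level < n) :
    c ∈ children G t ↔ c = ⟨t.level + 1, t.chosen⟩ ∨
      (G.IsIndepSet (insert (⟨t.level, h⟩ : Fin n) (t.chosen : Set (Fin n))) ∧
        c = ⟨t.level + 1, insert ⟨t.level, h⟩ t.chosen⟩) := by
  unfold children
  rw [dif_pos h]
  split_ifs with h' <;> rw [Finset.coe_insert] at h' <;> simp [h']

theorem level_of_mem_children {G : SimpleGraph (Fin n)} {t c : Node n} (h : t.level < n)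
    (hc : c ∈ children G t) : c.level = t.level + 1 := by
  rcases (mem_children h).1 hc with rfl | ⟨-, rfl⟩ <;> rfl

theorem IsTreeNode.of_mem_children {G : SimpleGraph (Fin n)} {t c : Node n} (h : t.level < n)
    (ht : IsTreeNode G t) (hc : c ∈ children G t) : IsTreeNode G c := by
  rcases (mem_children h).1 hc with rfl | ⟨hi, rfl⟩
  · exact ⟨h, fun j hj => (ht.2.1 j hj).trans (Nat.lt_succ_self _), ht.2.2⟩
  · refine ⟨h, fun j hj => ?_, by simpa using hi⟩
    rcases Finset.mem_insert.1 hj with rfl | hj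
    · simp
    · exact (ht.2.1 j hj).trans (Nat.lt_succ_self _)

theorem IsTreeNode.isAncestor_of_mem_children {G : SimpleGraph (Fin n)} {t c : Node n}
    (h : t.level < n) (ht : IsTreeNode G t) (hc : c ∈ children G t) : t.IsAncestor c := by
  refine ⟨by rw [level_of_mem_children h hc]; omega, ?_⟩
  rcases (mem_children h).1 hc with rfl | ⟨-, rfl⟩
  · exact (ht.truncate_eq le_rfl).symm
  · ext a
    have := ht.2.1 a
    simp only [mem_truncate, Finset.mem_insert]
    constructor
    · grind
    · rintro ⟨rfl | h1, h2⟩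
      · simp at h2
      · exact h1

theorem exists_child_of_isAncestor {G : SimpleGraph (Fin n)} {t : Node n} (h : t.level < n)
    {I : Finset (Fin n)} (hI : G.IsIndepSet (I : Set (Fin n)))
    (hanc : t.chosen = truncate t.level I) :
    ∃ c ∈ children G t, c.chosen = truncate c.level I := by
  by_cases hmem : (⟨t.level, h⟩ : Fin n) ∈ I
  · have hins : insert ⟨t.level, h⟩ t.chosen = truncate (t.level + 1) I := by
      ext a
      rw [hanc]
      simp only [mem_truncate, Finset.mem_insert, Fin.ext_iff]
      constructor
      · rintro (ha | ha)
        · have : a = ⟨t.level, h⟩ := Fin.ext ha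
          subst this
          exact ⟨hmem, by simp⟩
        · exact ⟨ha.1, by omega⟩
      · rintro ⟨h1, h2⟩
        by_cases ha : (a : ℕ) = t.level
        · exact Or.inl ha
        · exact Or.inr ⟨h1, by omega⟩
    refine ⟨_, (mem_children h).2 (Or.inr ⟨?_, rfl⟩), hins⟩
    rw [← Finset.coe_insert, hins]
    exact hI.mono fun a ha => (mem_truncate.1 (Finset.mem_coe.1 ha)).1
  · refine ⟨_, (mem_children h).2 (Or.inl rfl), ?_⟩
    rw [hanc]
    ext a
    simp only [mem_truncate]
    constructor
    · grind
    · rintro ⟨h1, h2⟩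
      refine ⟨h1, lt_of_le_of_ne (by omega) fun ha => hmem ?_⟩
      have : a = ⟨t.level, h⟩ := Fin.ext ha
      exact this ▸ h1

theorem card_le_potential {t : Node n} {I : Finset (Fin n)} (hanc : t.chosen = truncate t.level I) :
    I.card ≤ t.potential := by
  have h1 : I.card = (truncate t.level I).card +
      (I.filter fun j : Fin n => ¬ (j : ℕ) < t.level).card :=
    (Finset.card_filter_add_card_filter_not _).symm
  have h2 : (I.filter fun j : Fin n => ¬ (j : ℕ) < t.level).card ≤ n - t.level := by
    have : ((I.filter fun j : Fin n => ¬ (j : ℕ) < t.level).map Fin.valEmbedding) ⊆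
        Finset.Ico t.level n := by
      intro a ha
      simp only [Finset.mem_map, Finset.mem_filter, Fin.valEmbedding_apply] at ha
      obtain ⟨j, ⟨-, hj⟩, rfl⟩ := ha
      simp; omega
    simpa using Finset.card_le_card this
  unfold Node.potential
  rw [hanc]
  omega

open Classical in
/-- The nodes of the search tree of `G` with potential at least `m`. -/
noncomputable def promisingNodes (G : SimpleGraph (Fin n)) (m : ℕ) : Finset (Node n) :=
  ((Finset.range (n + 1) ×ˢ Finset.univ).image fun q => (⟨q.1, q.2⟩ : Node n)).filter
    fun t => IsTreeNode G t ∧ m ≤ t.potential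

theorem mem_promisingNodes {G : SimpleGraph (Fin n)} {m : ℕ} {t : Node n} :
    t ∈ promisingNodes G m ↔ IsTreeNode G t ∧ m ≤ t.potential := by
  classical
  simp only [promisingNodes, Finset.mem_filter, Finset.mem_image, Finset.mem_product,
    Finset.mem_range, Finset.mem_univ, and_true, and_iff_right_iff_imp]
  rintro ⟨h, -⟩
  exact ⟨(t.level, t.chosen), Nat.lt_succ_of_le h.1, rfl⟩

-- The open nodes form an antichain for the ancestor relation, and one of them is an ancestor of
-- `I`; both properties survive each step. The second forces the best node to have potential at
-- least `I.card`. The first makes each expansion remove the handled node from the set of promising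
-- descendants of the open nodes, so this set strictly shrinks.
open Classical in
theorem Run.le_card {G : SimpleGraph (Fin n)} {I : Finset (Fin n)}
    (hI : G.IsIndepSet (I : Set (Fin n))) {F : Finset (Node n)} {c : ℕ} (hrun : Run G F c)
    (hF : ∀ t ∈ F, IsTreeNode G t) (hanti : ∀ t ∈ F, ∀ u ∈ F, t.IsAncestor u → t = u)
    (hex : ∃ t ∈ F, t.chosen = truncate t.level I) :
    c ≤ ((promisingNodes G I.card).filter fun u => ∃ t ∈ F, t.IsAncestor u).card := by
  have self : ∀ {F : Finset (Node n)} {t : Node n}, IsBest F t → (∀ t ∈ F, IsTreeNode G t) →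
      (∃ t ∈ F, t.chosen = truncate t.level I) →
      t ∈ (promisingNodes G I.card).filter fun u => ∃ t ∈ F, t.IsAncestor u := by
    intro F t best hF hex
    obtain ⟨a, ha, haI⟩ := hex
    have htn := hF t best.1
    exact Finset.mem_filter.2 ⟨mem_promisingNodes.2 ⟨htn,
      (card_le_potential haI).trans (best.2 a ha)⟩, t, best.1, le_rfl, (htn.truncate_eq le_rfl).symm⟩
  induction hrun with
  | finish F t best leaf => exact Finset.card_pos.2 ⟨t, self best hF hex⟩
  | expand F t c best inner rest ih =>
    have htn := hF t best.1
    have hlev : ∀ u ∈ children G t, u.level = t.level + 1 :=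
      fun u hu => level_of_mem_children inner hu
    have hanc : ∀ u ∈ children G t, t.IsAncestor u :=
      fun u hu => htn.isAncestor_of_mem_children inner hu
    have hF' : ∀ u ∈ F.erase t ∪ children G t, IsTreeNode G u := by
      intro u hu
      rcases Finset.mem_union.1 hu with hu | hu
      · exact hF u (Finset.mem_of_mem_erase hu)
      · exact htn.of_mem_children inner hu
    have eq_of_level : ∀ u v : Node n, IsTreeNode G v → u.IsAncestor v → u.level = v.level →
        u = v := by
      intro u v hv h hl
      refine Node.ext hl ?_
      rw [h.2, hv.truncate_eq hl.ge]
    have hanti' : ∀ u ∈ F.erase t ∪ children G t, ∀ v ∈ F.erase t ∪ children G t,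
        u.IsAncestor v → u = v := by
      intro u hu v hv huv
      rcases Finset.mem_union.1 hu with hu' | hu' <;> rcases Finset.mem_union.1 hv with hv' | hv'
      · exact hanti u (Finset.mem_of_mem_erase hu') v (Finset.mem_of_mem_erase hv') huv
      -- An old open node above a new child is either above `t`, contradicting the antichain
      -- property, or on the level of the child and hence equal to it.
      · rcases (huv.1.trans (hlev v hv').le).lt_or_eq with hl | hl
        · refine absurd (hanti u (Finset.mem_of_mem_erase hu') t best.1 ?_)
            (Finset.ne_of_mem_erase hu')
          refine ⟨by omega, ?_⟩
          rw [huv.2, (hanc v hv').2, truncate_truncate (by omega)]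
        · exact eq_of_level u v (hF' v hv) huv (hl.trans (hlev v hv').symm)
      · exact absurd (hanti t best.1 v (Finset.mem_of_mem_erase hv') ((hanc u hu').trans huv)).symm
          (Finset.ne_of_mem_erase hv')
      · exact eq_of_level u v (hF' v hv) huv ((hlev u hu').trans (hlev v hv').symm)
    have hex' : ∃ u ∈ F.erase t ∪ children G t, u.chosen = truncate u.level I := by
      obtain ⟨a, ha, haI⟩ := hex
      by_cases hat : a = t
      · subst hat
        obtain ⟨u, hu, huI⟩ := exists_child_of_isAncestor inner hI haI
        exact ⟨u, Finset.mem_union_right _ hu, huI⟩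
      · exact ⟨a, Finset.mem_union_left _ (Finset.mem_erase.2 ⟨hat, ha⟩), haI⟩
    refine (Nat.succ_le_succ (ih hF' hanti' hex')).trans (Nat.succ_le_of_lt
      (Finset.card_lt_card (Finset.ssubset_iff_of_subset ?_ |>.2 ⟨t, self best hF hex, ?_⟩)))
    · intro u hu
      obtain ⟨hu, v, hv, hvu⟩ := Finset.mem_filter.1 hu
      refine Finset.mem_filter.2 ⟨hu, ?_⟩
      rcases Finset.mem_union.1 hv with hv | hv
      · exact ⟨v, Finset.mem_of_mem_erase hv, hvu⟩
      · exact ⟨t, best.1, (hanc v hv).trans hvu⟩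
    · intro hmem
      obtain ⟨-, v, hv, hvt⟩ := Finset.mem_filter.1 hmem
      rcases Finset.mem_union.1 hv with hv | hv
      · exact Finset.ne_of_mem_erase hv (hanti v (Finset.mem_of_mem_erase hv) t best.1 hvt)
      · have := hvt.1
        rw [hlev v hv] at this
        omega

/-- Best-first search handles only nodes whose potential is at least the size of any given
independent set. -/
theorem Run.le_card_promisingNodes {G : SimpleGraph (Fin n)} {I : Finset (Fin n)}
    (hI : G.IsIndepSet (I : Set (Fin n))) {c : ℕ} (hrun : Run G {root n} c) :
    c ≤ (promisingNodes G I.card).card := by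
  classical
  refine (hrun.le_card hI ?_ ?_ ?_).trans (Finset.card_filter_le _ _)
  · intro t ht
    rw [Finset.mem_singleton.1 ht]
    exact ⟨Nat.zero_le _, by simp [root], by simp [root, SimpleGraph.IsIndepSet]⟩
  · intro t ht u hu _
    rw [Finset.mem_singleton.1 ht, Finset.mem_singleton.1 hu]
  · exact ⟨root n, Finset.mem_singleton_self _, by simp [root, truncate]⟩

/-- No independent set of `G` has more than `b` vertices. -/
def IndepBound (G : SimpleGraph (Fin n)) (b : ℕ) : Prop :=
  ∀ I : Finset (Fin n), G.IsIndepSet (I : Set (Fin n)) → I.card ≤ b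

/-- The first `i` vertices. -/
def initial (n i : ℕ) : Finset (Fin n) := Finset.univ.filter fun j => (j : ℕ) < i

theorem card_initial {i : ℕ} (h : i ≤ n) : (initial n i).card = i := by
  unfold initial
  rw [Fin.card_filter_val_lt, min_eq_right h]

-- For a maximum independent set `I`, having potential at least `I.card` says exactly that no
-- independent set exceeds the potential.
open Classical in
theorem runningTime_le (G : SimpleGraph (Fin n)) :
    runningTime G ≤ ((∑ i ∈ Finset.range (n + 1), ∑ S ∈ (initial n i).powerset,
      if G.IsIndepSet (S : Set (Fin n)) ∧ IndepBound G (S.card + (n - i)) then 1 else 0 : ℕ) :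
        ENat) := by
  obtain ⟨I, hI, hmax⟩ := (Finset.univ.filter fun I : Finset (Fin n) =>
    G.IsIndepSet (I : Set (Fin n))).exists_max_image Finset.card
      ⟨∅, by simp [SimpleGraph.IsIndepSet]⟩
  simp only [Finset.mem_filter, Finset.mem_univ, true_and] at hI hmax
  refine iSup₂_le fun c hc => ?_
  refine Nat.cast_le.2 ((hc.le_card_promisingNodes hI).trans ?_)
  rw [Finset.sum_sigma', ← Finset.card_filter]
  refine Finset.card_le_card_of_injOn (fun t => ⟨t.level, t.chosen⟩) ?_ ?_
  · intro t ht
    obtain ⟨h, hp⟩ := mem_promisingNodes.1 (Finset.mem_coe.1 ht)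
    simp only [Finset.coe_filter, Finset.mem_sigma, Finset.mem_range, Finset.mem_powerset,
      Set.mem_ofPred_eq]
    exact ⟨⟨Nat.lt_succ_of_le h.1, fun j hj => by simpa [initial] using h.2.1 j hj⟩, h.2.2,
      fun J hJ => (hmax J hJ).trans hp⟩
  · intro t _ u _ h
    simp only [Sigma.mk.injEq, heq_eq_eq] at h
    exact Node.ext h.1 h.2

end BranchAndBound

namespace BranchAndBound

open MeasureTheory

/-! ### Probability estimates for binomial random graphs -/

section RandomGraph

variable {V : Type*} [Fintype V]

open Classical in
theorem sum_prod_edgeFinset {R : Type*} [CommSemiring R] (f g : Sym2 V → R) :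
    ∑ G : SimpleGraph V, (∏ e ∈ G.edgeFinset, f e) *
      ∏ e ∈ (⊤ : SimpleGraph V).edgeFinset \ G.edgeFinset, g e =
      ∏ e ∈ (⊤ : SimpleGraph V).edgeFinset, (f e + g e) := by
  rw [Finset.prod_add]
  refine Finset.sum_bij' (fun G _ => G.edgeFinset)
    (fun t _ => SimpleGraph.fromEdgeSet (t : Set (Sym2 V))) ?_ ?_ ?_ ?_ ?_
  · intro G _
    exact Finset.mem_powerset.2 (SimpleGraph.edgeFinset_mono le_top)
  · simp
  · intro G _
    simp
  · intro t ht
    ext e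
    have : e ∈ t → ¬ e.IsDiag := fun he => by simpa using Finset.mem_powerset.1 ht he
    simp
    tauto
  · simp

instance : MeasurableSingletonClass (SimpleGraph V) where
  measurableSet_singleton G := by
    have : ({G} : Set (SimpleGraph V)) = SimpleGraph.edgeSet ⁻¹' {G.edgeSet} := by
      ext H; simp
    rw [this]
    exact SimpleGraph.measurable_edgeSet (measurableSet_singleton _)

-- A change of weights: on `P` the factor `p ^ e(G)` is replaced by `c * ∏ f`. The sum is then
-- extended to all graphs, where it factors over the pairs of vertices. Taking `f = 0` on the pairs
-- inside a set bounds the probability of independence; `f = p * exp t` gives Chernoff's bound.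
open Classical in
theorem binomialRandom_real_le (p : unitInterval) (P : SimpleGraph V → Prop)
    (f : Sym2 V → ℝ) (c : ℝ) (hc : 0 ≤ c) (hf : ∀ e, 0 ≤ f e)
    (h : ∀ G, P G → (p : ℝ) ^ G.edgeFinset.card ≤ c * ∏ e ∈ G.edgeFinset, f e) :
    (SimpleGraph.binomialRandom V p).real {G | P G} ≤
      c * ∏ e ∈ (⊤ : SimpleGraph V).edgeFinset, (f e + (1 - p)) := by
  have hp : (0 : ℝ) ≤ 1 - p := sub_nonneg.2 p.2.2
  have h1 : (SimpleGraph.binomialRandom V p).real {G | P G} =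
      ∑ G ∈ Finset.univ.filter P, (SimpleGraph.binomialRandom V p).real {G} := by
    rw [sum_measureReal_singleton]
    congr
    ext G
    simp
  have h2 : ∀ G : SimpleGraph V, (SimpleGraph.binomialRandom V p).real {G} =
      (p : ℝ) ^ G.edgeFinset.card *
        ∏ e ∈ (⊤ : SimpleGraph V).edgeFinset \ G.edgeFinset, (1 - (p : ℝ)) := by
    intro G
    rw [measureReal_def, SimpleGraph.binomialRandom_singleton, Finset.prod_const,
      Finset.card_sdiff_of_subset (SimpleGraph.edgeFinset_mono le_top),
      SimpleGraph.card_edgeFinset_top_eq_card_choose_two, Nat.card_eq_fintype_card,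
      ← SimpleGraph.coe_edgeFinset, Set.ncard_coe_finset]
    simp
  rw [h1, ← sum_prod_edgeFinset, Finset.mul_sum]
  refine (Finset.sum_le_sum fun G hG => ?_).trans
    (Finset.sum_le_sum_of_subset_of_nonneg (Finset.filter_subset P _) fun G _ _ => ?_)
  · rw [h2 G, ← mul_assoc]
    exact mul_le_mul_of_nonneg_right (h G (Finset.mem_filter.1 hG).2)
      (Finset.prod_nonneg fun _ _ => hp)
  · exact mul_nonneg hc (mul_nonneg (Finset.prod_nonneg fun _ _ => hf _)
      (Finset.prod_nonneg fun _ _ => hp))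

open Classical in
theorem binomialRandom_real_isIndepSet_le (p : unitInterval) (S : Finset V) :
    (SimpleGraph.binomialRandom V p).real {G | G.IsIndepSet (S : Set V)} ≤
      (1 - p : ℝ) ^ S.card.choose 2 := by
  refine (binomialRandom_real_le p _ (fun e => if e ∈ S.sym2 then 0 else (p : ℝ)) 1 zero_le_one
    (fun e => ?_) fun G hG => ?_).trans ?_
  · have := p.2.1
    split_ifs <;> simp [this]
  · rw [one_mul, ← Finset.prod_const]
    refine (Finset.prod_congr rfl fun e he => ?_).le
    rw [if_neg]
    intro hS
    induction e using Sym2.ind with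
    | _ u v =>
      rw [Finset.mk_mem_sym2_iff] at hS
      have hadj : G.Adj u v := by simpa using he
      exact hG (Finset.mem_coe.2 hS.1) (Finset.mem_coe.2 hS.2) hadj.ne hadj
  · rw [one_mul, ← Sym2.card_image_offDiag, ← Finset.prod_const,
      ← Finset.prod_filter_mul_prod_filter_not _ (fun e => e ∈ S.sym2)]
    have h1 : ∏ e ∈ (⊤ : SimpleGraph V).edgeFinset with e ∉ S.sym2,
        ((if e ∈ S.sym2 then 0 else (p : ℝ)) + (1 - p)) = 1 := by
      refine Finset.prod_eq_one fun e he => ?_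
      rw [if_neg (Finset.mem_filter.1 he).2]
      ring
    have h2 : ((⊤ : SimpleGraph V).edgeFinset.filter fun e => e ∈ S.sym2) =
        S.offDiag.image Sym2.mk.uncurry := by
      ext e
      induction e using Sym2.ind with
      | _ u v =>
        simp
        grind
    rw [h1, mul_one, ← h2]
    refine (Finset.prod_congr rfl fun e he => ?_).le
    rw [if_pos (Finset.mem_filter.1 he).2, zero_add]

open Classical in
/-- The Chernoff bound for the number of edges of a binomial random graph. -/
theorem binomialRandom_real_card_edgeFinset_ge_le (p : unitInterval) (t M : ℝ) (ht : 0 ≤ t) :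
    (SimpleGraph.binomialRandom V p).real {G | M ≤ G.edgeFinset.card} ≤
      Real.exp (p * (Fintype.card V).choose 2 * (Real.exp t - 1) - t * M) := by
  refine (binomialRandom_real_le p _ (fun _ => p * Real.exp t) (Real.exp (-(t * M)))
    (Real.exp_pos _).le (fun _ => mul_nonneg p.2.1 (Real.exp_pos _).le) fun G hG => ?_).trans ?_
  · rw [Finset.prod_const, mul_pow, ← Real.exp_nat_mul, mul_left_comm, ← Real.exp_add]
    refine le_mul_of_one_le_right (pow_nonneg p.2.1 _) (Real.one_le_exp ?_)
    have := mul_le_mul_of_nonneg_left hG ht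
    linarith
  · rw [Finset.prod_const, SimpleGraph.card_edgeFinset_top_eq_card_choose_two]
    have h0 : (0 : ℝ) ≤ p * Real.exp t + (1 - p) :=
      add_nonneg (mul_nonneg p.2.1 (Real.exp_pos _).le) (sub_nonneg.2 p.2.2)
    have h1 : (p : ℝ) * Real.exp t + (1 - p) ≤ Real.exp (p * (Real.exp t - 1)) := by
      have := Real.add_one_le_exp ((p : ℝ) * (Real.exp t - 1))
      linarith
    calc Real.exp (-(t * M)) * (p * Real.exp t + (1 - p) : ℝ) ^ (Fintype.card V).choose 2
        ≤ Real.exp (-(t * M)) * Real.exp (p * (Real.exp t - 1)) ^ (Fintype.card V).choose 2 := by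
          gcongr
      _ = _ := by
          rw [← Real.exp_nat_mul, ← Real.exp_add]
          ring_nf

open Classical in
theorem _root_.SimpleGraph.CliqueFree.two_mul_mul_card_edgeFinset_le {G : SimpleGraph V} {r : ℕ}
    (hr : 0 < r) (h : G.CliqueFree (r + 1)) :
    2 * r * G.edgeFinset.card ≤ (r - 1) * Fintype.card V ^ 2 := by
  obtain ⟨H, _, maxH⟩ := SimpleGraph.exists_isTuranMaximal (V := V) hr
  refine le_trans (Nat.mul_le_mul_left _ ?_)
    (SimpleGraph.mul_card_edgeFinset_turanGraph_le (n := Fintype.card V) (r := r))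
  rw [←
    ((SimpleGraph.isTuranMaximal_iff_nonempty_iso_turanGraph hr).mp maxH).some.card_edgeFinset_eq]
  convert! maxH.2 h

end RandomGraph

/-! ### Small independence number: Turán and Chernoff -/

variable {n : ℕ}

-- Turán's theorem for the complement graph, which has no clique on `b + 1` vertices.
open Classical in
theorem IndepBound.sq_le {G : SimpleGraph (Fin n)} {b : ℕ} (hb : 0 < b) (h : IndepBound G b) :
    n ^ 2 ≤ b * (2 * G.edgeFinset.card + n) := by
  have hfree : Gᶜ.CliqueFree (b + 1) := by
    intro s hs
    have := h s ((SimpleGraph.isClique_compl G).1 hs.isClique)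
    rw [hs.card_eq] at this
    omega
  have h1 := hfree.two_mul_mul_card_edgeFinset_le hb
  have h2 : G.edgeFinset.card + Gᶜ.edgeFinset.card = n.choose 2 := by
    rw [← Finset.card_union_of_disjoint
      (SimpleGraph.disjoint_edgeFinset.2 disjoint_compl_right), ← SimpleGraph.edgeFinset_sup]
    have := SimpleGraph.card_edgeFinset_top_eq_card_choose_two (V := Fin n)
    rw [Fintype.card_fin] at this
    rw [← this]
    congr!
    exact sup_compl_eq_top
  rw [Fintype.card_fin] at h1
  have h3 : 2 * n.choose 2 + n = n ^ 2 := by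
    rw [mul_comm, Nat.choose_two_right, Nat.div_mul_cancel (Nat.even_mul_pred_self n).two_dvd]
    cases n
    · rfl
    · simp; ring
  obtain ⟨b, rfl⟩ : ∃ c, b = c + 1 := ⟨b - 1, by omega⟩
  simp only [Nat.add_sub_cancel] at h1
  have h4 : (b + 1) * (2 * G.edgeFinset.card + n) + 2 * (b + 1) * Gᶜ.edgeFinset.card =
      (b + 1) * n ^ 2 := by
    rw [← h3, ← h2]
    ring
  refine le_of_add_le_add_right (a := 2 * (b + 1) * Gᶜ.edgeFinset.card) ?_
  rw [h4, add_one_mul, add_comm]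
  convert Nat.add_le_add_right h1 (n ^ 2)

theorem binomialRandom_real_indepBound_le {k : ℝ} (hk : 0 < k) {p : unitInterval}
    (hn : 0 < n) (hp : (p : ℝ) = k / n) {b : ℕ} (hb : 0 < b) (hkb : k + 1 < 1 / ((b : ℝ) / n)) :
    2 ^ n * (SimpleGraph.binomialRandom (Fin n) p).real {G | IndepBound G b} ≤
      Real.exp (n * (mu k (1 / ((b : ℝ) / n)) / 2)) := by
  classical
  have hn' : (0 : ℝ) < n := by exact_mod_cast hn
  have hb' : (0 : ℝ) < b := by exact_mod_cast hb
  rw [mu, if_pos hkb]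
  set l : ℝ := 1 / ((b : ℝ) / n) with hl
  have hlb : l * b = n := by rw [hl]; field_simp
  have hl1 : 0 < l - 1 := by linarith
  -- The Chernoff parameter `t = log ((l - 1) / k)` is optimal when the mean `k * n / 2` is compared
  -- with the threshold `n * (l - 1) / 2`; it is nonnegative because `l > k + 1`.
  have ht : 0 ≤ Real.log ((l - 1) / k) := Real.log_nonneg (by rw [le_div_iff₀ hk]; linarith)
  have hsub : {G : SimpleGraph (Fin n) | IndepBound G b} ⊆
      {G | (n : ℝ) * (l - 1) / 2 ≤ G.edgeFinset.card} := by
    intro G hG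
    have h1 : (n : ℝ) ^ 2 ≤ b * (2 * G.edgeFinset.card + n) := by
      exact_mod_cast IndepBound.sq_le hb hG
    have h2 : (b : ℝ) * (n * l) ≤ b * (2 * G.edgeFinset.card + n) := by nlinarith
    have h3 := le_of_mul_le_mul_left h2 hb'
    simp only [Set.mem_ofPred_eq]
    linarith
  have h1 := (measureReal_mono (μ := SimpleGraph.binomialRandom (Fin n) p) hsub).trans
    (binomialRandom_real_card_edgeFinset_ge_le p _ _ ht)
  have h2 : (p : ℝ) * (n.choose 2 : ℕ) ≤ k * n / 2 := by
    rw [Nat.cast_choose_two, hp]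
    have : k / n * (n * (n - 1) / 2) = k * (n - 1) / 2 := by field_simp
    rw [this]
    nlinarith
  have hlog : Real.log (k / (l - 1)) = -Real.log ((l - 1) / k) := by
    rw [← Real.log_inv, inv_div]
  have hexp : Real.exp (Real.log ((l - 1) / k)) - 1 = (l - 1 - k) / k := by
    rw [Real.exp_log (div_pos hl1 hk)]
    field_simp
  have h3 : (p : ℝ) * (n.choose 2 : ℕ) * (Real.exp (Real.log ((l - 1) / k)) - 1) ≤
      n * (l - 1 - k) / 2 := by
    rw [hexp]
    calc _ ≤ k * n / 2 * ((l - 1 - k) / k) :=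
          mul_le_mul_of_nonneg_right h2 (div_nonneg (by linarith) hk.le)
      _ = _ := by field_simp
  have h4 : (2 : ℝ) ^ n = Real.exp (n * Real.log 2) := by
    rw [Real.exp_nat_mul, Real.exp_log two_pos]
  rw [Fintype.card_fin] at h1
  rw [h4]
  refine (mul_le_mul_of_nonneg_left h1 (Real.exp_pos _).le).trans ?_
  rw [← Real.exp_add, hlog]
  apply Real.exp_le_exp.2
  linarith

open Classical in
theorem averageRunningTime_le (n : ℕ) (p : unitInterval) :
    averageRunningTime n p ≤ ENNReal.ofReal (∑ i ∈ Finset.range (n + 1),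
      ∑ S ∈ (initial n i).powerset, (SimpleGraph.binomialRandom (Fin n) p).real
        {G | G.IsIndepSet (S : Set (Fin n)) ∧ IndepBound G (S.card + (n - i))}) := by
  have h1 : averageRunningTime n p ≤ ∫⁻ G, ∑ i ∈ Finset.range (n + 1),
      ∑ S ∈ (initial n i).powerset, Set.indicator
        {G : SimpleGraph (Fin n) | G.IsIndepSet (S : Set (Fin n)) ∧
          IndepBound G (S.card + (n - i))} 1 G ∂(SimpleGraph.binomialRandom (Fin n) p) := by
    refine lintegral_mono fun G => ?_
    refine (ENat.toENNReal_mono (runningTime_le G)).trans ?_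
    rw [ENat.toENNReal_coe]
    push_cast
    simp [Set.indicator_apply]
  have hmeas : ∀ s : Set (SimpleGraph (Fin n)), MeasurableSet s := fun s =>
    s.toFinite.measurableSet
  refine h1.trans (le_of_eq ?_)
  rw [lintegral_finsetSum _ fun i _ => Finset.measurable_sum _ fun S _ =>
    measurable_one.indicator (hmeas _)]
  rw [ENNReal.ofReal_sum_of_nonneg fun i _ => Finset.sum_nonneg fun S _ => measureReal_nonneg]
  refine Finset.sum_congr rfl fun i _ => ?_
  rw [lintegral_finsetSum _ fun S _ => measurable_one.indicator (hmeas _),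
    ENNReal.ofReal_sum_of_nonneg fun S _ => measureReal_nonneg]
  refine Finset.sum_congr rfl fun S _ => ?_
  rw [lintegral_indicator_one (hmeas _), ofReal_measureReal]

end BranchAndBound

namespace BranchAndBound

/-! ### Bounds for the exponents ψ and μ -/

open Real

theorem psi_eq (k x : ℝ) : psi k x = binEntropy x - k * x ^ 2 / 2 := by
  rw [psi, binEntropy_eq_negMulLog_add_negMulLog_one_sub, negMulLog, negMulLog]
  ring

/-- The quadratic Taylor polynomial at `1 / 2` is an upper bound for the binary entropy. -/
theorem binEntropy_le_quadratic {x : ℝ} (h0 : 0 ≤ x) (h1 : x ≤ 1) :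
    binEntropy x ≤ log 2 - 2 * (x - 1 / 2) ^ 2 := by
  have key : ∀ y ∈ Set.Ico (0 : ℝ) (1 / 2),
      binEntropy (1 / 2 + y) ≤ log 2 - 2 * y ^ 2 := by
    have hd : ∀ y ∈ Set.Ico (0 : ℝ) (1 / 2), HasDerivAt
        (fun y : ℝ => log 2 - 2 * y ^ 2 - binEntropy (1 / 2 + y))
        (-(4 * y) - (log (1 - (1 / 2 + y)) - log (1 / 2 + y))) y := by
      intro y hy
      have hb := (hasDerivAt_binEntropy (p := 1 / 2 + y) (by linarith [hy.1])
        (by linarith [hy.2])).comp y ((hasDerivAt_id y).const_add (1 / 2))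
      have := (((hasDerivAt_pow 2 y).const_mul 2).const_sub (log 2)).sub hb
      refine this.congr_deriv ?_
      norm_num
      ring
    have hmono : MonotoneOn (fun y : ℝ => log 2 - 2 * y ^ 2 - binEntropy (1 / 2 + y))
        (Set.Ico 0 (1 / 2)) := by
      refine monotoneOn_of_hasDerivWithinAt_nonneg (convex_Ico _ _)
        (fun y hy => (hd y hy).continuousAt.continuousWithinAt)
        (fun y hy => (hd y (interior_subset hy)).hasDerivWithinAt) ?_
      intro y hy
      have hy := interior_subset hy
      -- The derivative is `log ((1 + 2y) / (1 - 2y)) - 4y`, and `4y` comes from the first term of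
      -- the logarithm series.
      have h2 := sum_range_le_log_div (x := 2 * y) (by linarith [hy.1]) (by linarith [hy.2]) 1
      have h3 : log ((1 + 2 * y) / (1 - 2 * y)) =
          log (1 / 2 + y) - log (1 - (1 / 2 + y)) := by
        rw [← log_div (by linarith [hy.1]) (by linarith [hy.2])]
        congr 1
        rw [div_eq_div_iff (by linarith [hy.2]) (by linarith [hy.2])]
        ring
      rw [h3] at h2
      simp at h2
      norm_num at h2 ⊢
      linarith
    intro y hy
    have := hmono (a := 0) ⟨le_rfl, by norm_num⟩ hy hy.1
    simp only [add_zero, one_div, binEntropy_two_inv] at this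
    norm_num at this ⊢
    exact this
  have h2 : (1 / 2 : ℝ) ≤ log 2 := by linarith [log_two_gt_d9]
  rcases le_total (1 / 2) x with h | h
  · rcases h1.eq_or_lt with rfl | h1
    · simp; linarith
    · have := key (x - 1 / 2) ⟨by linarith, by linarith⟩
      rwa [add_sub_cancel] at this
  · rcases h0.eq_or_lt with rfl | h0
    · simp; linarith
    · have := key (1 / 2 - x) ⟨by linarith, by linarith⟩
      rw [show 1 / 2 + (1 / 2 - x) = 1 - x by ring, binEntropy_one_sub] at this
      linarith [sq_abs (x - 1 / 2), show (1 / 2 - x) ^ 2 = (x - 1 / 2) ^ 2 by ring]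

theorem mu_of_lt {k l : ℝ} (h : k + 1 < l) :
    mu k l = 2 * log 2 + l - (k + 1) + (l - 1) * log (k / (l - 1)) := if_pos h

theorem mu_of_le {k l : ℝ} (h : l ≤ k + 1) : mu k l = 2 * log 2 := if_neg h.not_gt

theorem min_le_log_two {k x : ℝ} (hk : 0 < k) :
    min (psi k x) (mu k (1 / x) / 2) ≤ log 2 := by
  refine (min_le_left _ _).trans ?_
  rw [psi_eq]
  have := binEntropy_le_log_two (p := x)
  have : 0 ≤ k * x ^ 2 / 2 := by positivity
  linarith

theorem exp_min_le_gamma {k x : ℝ} (hk : 0 < k) (hx : x ∈ Set.Ioc (0 : ℝ) 1) :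
    exp (min (psi k x) (mu k (1 / x) / 2)) ≤ gamma k := by
  refine le_csSup ⟨exp (log 2), ?_⟩ ⟨x, hx, rfl⟩
  rintro _ ⟨y, _, rfl⟩
  exact exp_le_exp.2 (min_le_log_two hk)

theorem gamma_le {k c : ℝ}
    (h : ∀ x ∈ Set.Ioc (0 : ℝ) 1, min (psi k x) (mu k (1 / x) / 2) ≤ c) : gamma k ≤ exp c := by
  refine csSup_le ⟨_, 1, ⟨one_pos, le_rfl⟩, rfl⟩ ?_
  rintro _ ⟨x, hx, rfl⟩
  exact exp_le_exp.2 (h x hx)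

theorem psi_le_half_mu {k z : ℝ} (hk : 0 < k) (h : 1 / z ≤ k + 1) :
    psi k z ≤ mu k (1 / z) / 2 := by
  rw [mu_of_le h, psi_eq]
  have := binEntropy_le_log_two (p := z)
  have : 0 ≤ k * z ^ 2 / 2 := by positivity
  linarith

theorem exp_psi_le_gamma {k z : ℝ} (hk : 0 < k) (hz : z ∈ Set.Ioc (0 : ℝ) 1)
    (h : 1 / z ≤ k + 1) : exp (psi k z) ≤ gamma k := by
  have := exp_min_le_gamma hk hz
  rwa [min_eq_left (psi_le_half_mu hk h)] at this

/-- At `z = 1 / (k + 1)` the bound `-log z ≥ 1 - z` gives `-z log z ≥ z (1 - z)`, twice the penalty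
`k z² / 2`. -/
theorem one_le_gamma {k : ℝ} (hk : 0 < k) : 1 ≤ gamma k := by
  have hz : (1 / (k + 1)) ∈ Set.Ioc (0 : ℝ) 1 :=
    ⟨by positivity, by rw [div_le_one (by positivity)]; linarith⟩
  refine le_trans (one_le_exp ?_) (exp_psi_le_gamma hk hz (by rw [one_div_one_div]))
  set z := 1 / (k + 1) with hzdef
  have hkz : (k + 1) * z = 1 := by rw [hzdef]; field_simp
  have hlog : log z ≤ z - 1 := log_le_sub_one_of_pos hz.1
  have h1 : (1 - z) * log (1 - z) ≤ 0 :=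
    mul_nonpos_of_nonneg_of_nonpos (by linarith [hz.2])
      (log_nonpos (by linarith [hz.2]) (by linarith [hz.1]))
  have h2 : z * log z ≤ z * (z - 1) := mul_le_mul_of_nonneg_left hlog hz.1.le
  have h3 : k * z ^ 2 = (1 - z) * z := by
    have : k * z = 1 - z := by linarith
    rw [sq, ← mul_assoc, this]
  have h4 : 0 ≤ (1 - z) * z := mul_nonneg (by linarith [hz.2]) hz.1.le
  rw [psi]
  nlinarith

theorem log_lower {x : ℝ} (h0 : 0 ≤ x) (h : x < 1) (n : ℕ) {a : ℝ}
    (ha : (1 + x) / (1 - x) = a) :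
    2 * ∑ i ∈ Finset.range n, x ^ (2 * i + 1) / (2 * i + 1) ≤ log a := by
  have := sum_range_le_log_div h0 h n
  rw [ha] at this
  linarith

theorem log_upper {x : ℝ} (h0 : 0 ≤ x) (h : x < 1) (n : ℕ) {a : ℝ}
    (ha : (1 + x) / (1 - x) = a) :
    log a ≤ 2 * ((∑ i ∈ Finset.range n, x ^ (2 * i + 1) / (2 * i + 1)) +
      x ^ (2 * n + 1) / (1 - x ^ 2)) := by
  have := log_div_le_sum_range_add h0 h n
  rw [ha] at this
  linarith

theorem le_log_base : log 2 - 0.06893 ≤ log 1.8668 := by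
  have h := log_upper (x := 0.1332 / 3.8668) (by norm_num) (by norm_num) 2
    (a := 2 / 1.8668) (by norm_num)
  rw [log_div (by norm_num) (by norm_num)] at h
  norm_num [Finset.sum_range_succ] at h ⊢
  linarith

theorem le_log_eleven_sixths : 0.6061 ≤ log (11 / 6) := by
  have h := log_lower (x := 5 / 17) (by norm_num) (by norm_num) 4
    (a := 11 / 6) (by norm_num)
  norm_num [Finset.sum_range_succ] at h ⊢
  linarith

/-- The quintic is `(x - 0.526)²` times a cubic that is nonnegative on this range, plus a linear
remainder with positive coefficients. -/
theorem quintic_nonneg {x : ℝ} (h0 : 0.28 ≤ x) :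
    0 ≤ (1.5 * (x - 1 / 2) ^ 2 - 0.06893) * (8 * x * (1 + 3 * x ^ 2)) +
      (1 - x) * (1.6061 * (1 + 3 * x ^ 2) - 11 / 6) := by
  have h1 : 0 ≤ 36 * x ^ 3 + 1.872 * x ^ 2 + 6.536388 * x - 0.823357296 := by
    have h2 : 0 ≤ x ^ 3 := by positivity
    have h3 : 0 ≤ x ^ 2 := by positivity
    linarith
  have h2 := mul_nonneg (sq_nonneg (x - 0.526)) h1
  nlinarith

/-- If `1 / x ≤ k + 1`, then `k x² ≥ x (1 - x)` and ψ alone is at most `log 2 - 1 / 8`. Otherwise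
the weights 3/4 and 1/4 are used, and the bound obtained no longer contains `k`. -/
theorem min_le {k x : ℝ} (hk : 0 < k) (h0 : 0 < x) (h1 : x ≤ 1) :
    min (psi k x) (mu k (1 / x) / 2) ≤ log 2 - 0.06893 := by
  have hH := binEntropy_le_quadratic h0.le h1
  rcases le_or_gt (1 / x) (k + 1) with hl | hl
  · refine (min_le_left _ _).trans ?_
    rw [div_le_iff₀ h0] at hl
    have h2 : x * (1 - x) ≤ k * x ^ 2 := by nlinarith
    rw [psi_eq]
    nlinarith [sq_nonneg (x - 1 / 2)]
  · have hx1 : x < 1 := by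
      rw [lt_div_iff₀ h0] at hl
      nlinarith
    have hl1 : 0 < 1 / x - 1 := by linarith
    have hu : 0 < 1 + 3 * x ^ 2 := by positivity
    -- The tangent to the logarithm with slope parameter `1 + 3 * x ^ 2` is chosen so that the terms
    -- linear in `k` cancel in the weighted average: `-(3/4) x²/2 + (1/8)(-1 + 1 + 3x²) = 0`.
    have hlog : log (k / (1 / x - 1)) ≤
        k * (1 + 3 * x ^ 2) / (1 / x - 1) - 1 - log (1 + 3 * x ^ 2) := by
      have h2 := log_le_sub_one_of_pos (mul_pos (div_pos hk hl1) hu)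
      rw [log_mul (div_pos hk hl1).ne' hu.ne'] at h2
      have h3 : k / (1 / x - 1) * (1 + 3 * x ^ 2) = k * (1 + 3 * x ^ 2) / (1 / x - 1) := by ring
      linarith
    have hmul : (1 / x - 1) * log (k / (1 / x - 1)) ≤
        k * (1 + 3 * x ^ 2) - (1 / x - 1) - (1 / x - 1) * log (1 + 3 * x ^ 2) := by
      refine (mul_le_mul_of_nonneg_left hlog hl1.le).trans (le_of_eq ?_)
      have h3 : (1 / x - 1) * (k * (1 + 3 * x ^ 2) / (1 / x - 1)) = k * (1 + 3 * x ^ 2) :=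
        mul_div_cancel₀ _ hl1.ne'
      linear_combination h3
    have hmin : min (psi k x) (mu k (1 / x) / 2) ≤
        3 / 4 * psi k x + 1 / 4 * (mu k (1 / x) / 2) := by
      have h2 := min_le_left (psi k x) (mu k (1 / x) / 2)
      have h3 := min_le_right (psi k x) (mu k (1 / x) / 2)
      linarith
    have hmain : min (psi k x) (mu k (1 / x) / 2) ≤
        3 / 4 * binEntropy x + 1 / 4 * log 2 - (1 / x - 1) * log (1 + 3 * x ^ 2) / 8 := by
      rw [mu_of_lt hl, psi_eq] at hmin
      rw [mu_of_lt hl, psi_eq]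
      linarith
    refine hmain.trans ?_
    rcases lt_or_ge x 0.28 with hx | hx
    -- Far from `1 / 2` the quadratic entropy loss suffices: `1.5 * 0.22 ^ 2 > 0.06893`.
    · have h2 : 0 ≤ (1 / x - 1) * log (1 + 3 * x ^ 2) :=
        mul_nonneg hl1.le (log_nonneg (by nlinarith))
      nlinarith
    -- The logarithm is bounded at `11 / 6`, which is close to `1 + 3 * x ^ 2` at the critical `x ≈
    -- 0.526`.
    · have h2 : 1.6061 - 11 / 6 / (1 + 3 * x ^ 2) ≤ log (1 + 3 * x ^ 2) := by
        have h3 := log_le_sub_one_of_pos (div_pos (by norm_num : (0 : ℝ) < 11 / 6) hu)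
        rw [log_div (by norm_num) hu.ne'] at h3
        have := le_log_eleven_sixths
        norm_num at this ⊢
        linarith
      have h4 := mul_le_mul_of_nonneg_left h2 hl1.le
      have h5 : 0 ≤ 1.5 * (x - 1 / 2) ^ 2 - 0.06893 +
          (1 / x - 1) * (1.6061 - 11 / 6 / (1 + 3 * x ^ 2)) / 8 := by
        have h6 := div_nonneg (quintic_nonneg hx) (by positivity : 0 ≤ 8 * x * (1 + 3 * x ^ 2))
        refine h6.trans (le_of_eq ?_)
        field_simp
      norm_num at h5 h4 ⊢
      linarith

theorem gamma_le_base {k : ℝ} (hk : 0 < k) : gamma k ≤ 1.8668 := by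
  rw [← exp_log (by norm_num : (0 : ℝ) < 1.8668)]
  exact gamma_le fun x hx => (min_le hk hx.1 hx.2).trans le_log_base

/-- The point `x = 0.5335` is where ψ and μ/2 nearly agree for `k = 0.47`. -/
theorem le_gamma_special : 1.866 ≤ gamma 0.47 := by
  refine le_trans ?_ (exp_min_le_gamma (x := 0.5335) (by norm_num) ⟨by norm_num, by norm_num⟩)
  rw [← log_le_iff_le_exp (by norm_num)]
  have e1 := log_upper (x := 0.067 / 2.067) (by norm_num) (by norm_num) 2 (a := 1.067)
    (by norm_num)
  have e2 := log_lower (x := 0.067 / 1.933) (by norm_num) (by norm_num) 2 (a := 1 / 0.933)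
    (by norm_num)
  have e3 := log_lower (x := 0.075 / 2.075) (by norm_num) (by norm_num) 2 (a := 1.075)
    (by norm_num)
  have hl2 := log_two_lt_d9
  have hl2' := log_two_gt_d9
  rw [one_div, log_inv] at e2
  have f1 : log 0.5335 = log 1.067 - log 2 := by
    rw [← log_div (by norm_num) (by norm_num)]
    norm_num
  have f2 : log (1 - 0.5335) = log 0.933 - log 2 := by
    rw [← log_div (by norm_num) (by norm_num)]
    norm_num
  have f3 : log 1.866 = log 0.933 + log 2 := by
    rw [← log_mul (by norm_num) (by norm_num)]
    norm_num
  have f4 : log 1.075 - log 2 ≤ log (0.47 / (1 / 0.5335 - 1)) := by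
    rw [← log_div (by norm_num) (by norm_num)]
    exact log_le_log (by norm_num) (by norm_num)
  refine le_min ?_ ?_
  · rw [psi, f1, f2, f3]
    norm_num [Finset.sum_range_succ] at e1 e2 ⊢
    linarith
  · rw [mu_of_lt (by norm_num), f3]
    norm_num [Finset.sum_range_succ] at e2 e3 f4 ⊢
    linarith

/-! ### Limits of γ at zero and at infinity -/

theorem tendsto_gamma_of_le {l : Filter ℝ} (hl : ∀ᶠ k in l, 0 < k)
    (h : ∀ ε > 0, ∀ᶠ k in l, ∀ x ∈ Set.Ioc (0 : ℝ) 1, min (psi k x) (mu k (1 / x) / 2) ≤ ε) :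
    Filter.Tendsto gamma l (nhds 1) := by
  refine tendsto_order.2 ⟨fun a ha => ?_, fun a ha => ?_⟩
  · filter_upwards [hl] with k hk using ha.trans_le (one_le_gamma hk)
  · have hlog := log_pos ha
    filter_upwards [h (log a / 2) (half_pos hlog)] with k hk
    refine (gamma_le hk).trans_lt ?_
    rw [← lt_log_iff_exp_lt (by linarith)]
    linarith

theorem exists_binEntropy_le {ε : ℝ} (hε : 0 < ε) :
    ∃ δ > 0, δ < 1 ∧ ∀ x, 0 ≤ x → x < δ → binEntropy x ≤ ε := by
  have h := binEntropy_continuous.tendsto 0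
  rw [binEntropy_zero] at h
  obtain ⟨δ, hδ, h⟩ := Metric.eventually_nhds_iff.1 (h.eventually (gt_mem_nhds hε))
  refine ⟨min δ (1 / 2), lt_min hδ (by norm_num),
    (min_le_right _ _).trans_lt (by norm_num), fun x h0 hx => (h ?_).le⟩
  rw [Real.dist_eq, sub_zero, abs_of_nonneg h0]
  exact hx.trans_le (min_le_left _ _)

/-- Only ψ is needed: the entropy is small for small `x`, and elsewhere the penalty `k x² / 2`
exceeds `log 2`. -/
theorem tendsto_gamma_atTop : Filter.Tendsto gamma Filter.atTop (nhds 1) := by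
  refine tendsto_gamma_of_le (Filter.eventually_gt_atTop 0) fun ε hε => ?_
  obtain ⟨δ, hδ, -, h⟩ := exists_binEntropy_le hε
  filter_upwards [Filter.eventually_ge_atTop (2 * log 2 / δ ^ 2), Filter.eventually_gt_atTop 0]
    with k hk hk0 x hx
  refine (min_le_left _ _).trans ?_
  rw [psi_eq]
  rcases lt_or_ge x δ with hxδ | hxδ
  · have := h x hx.1.le hxδ
    have : 0 ≤ k * x ^ 2 / 2 := by positivity
    linarith
  · rw [div_le_iff₀ (by positivity)] at hk
    have h1 := binEntropy_le_log_two (p := x)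
    have h2 : k * δ ^ 2 ≤ k * x ^ 2 := by gcongr
    linarith

theorem tendsto_gamma_zero :
    Filter.Tendsto gamma (nhdsWithin 0 (Set.Ioi 0)) (nhds 1) := by
  refine tendsto_gamma_of_le self_mem_nhdsWithin fun ε hε => ?_
  obtain ⟨δ, hδ, hδ1, h⟩ := exists_binEntropy_le hε
  -- For `k ≤ c` and `1 - x ≥ δ` the logarithm in μ is at most `-1 - 2 log 2 / δ`: the `-1` cancels
  -- `l - 1`, the rest cancels `2 log 2`. For `x` near 1 the entropy is small.
  set c : ℝ := δ * exp (-1 - 2 * log 2 / δ) with hc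
  have hcpos : 0 < c := by positivity
  filter_upwards [self_mem_nhdsWithin, nhdsWithin_le_nhds (Iic_mem_nhds hcpos)] with k hk hkc x hx
  have hk : 0 < k := hk
  have hkc : k ≤ c := hkc
  rcases lt_or_ge (1 - x) δ with hxδ | hxδ
  · refine (min_le_left _ _).trans ?_
    rw [psi_eq, ← binEntropy_one_sub]
    have := h (1 - x) (by linarith [hx.2]) hxδ
    have : 0 ≤ k * x ^ 2 / 2 := by positivity
    linarith
  · refine (min_le_right _ _).trans ?_
    have hlx : δ ≤ 1 / x - 1 := by
      have : δ ≤ (1 - x) / x := hxδ.trans (le_div_self (by linarith) hx.1 hx.2)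
      rwa [sub_div, div_self hx.1.ne'] at this
    have hnn : 0 ≤ 2 * log 2 / δ := by positivity
    have hcδ : c < δ := by
      have : exp (-1 - 2 * log 2 / δ) < 1 := (exp_lt_exp.2 (by linarith)).trans_eq exp_zero
      rw [hc]
      nlinarith
    rw [mu_of_lt (by linarith)]
    have hlog : log (k / (1 / x - 1)) ≤ -1 - 2 * log 2 / δ := by
      rw [log_le_iff_le_exp (div_pos hk (by linarith)), div_le_iff₀ (by linarith), mul_comm]
      exact hkc.trans (by rw [hc]; gcongr)
    have h1 := mul_le_mul_of_nonneg_left hlog (by linarith : 0 ≤ 1 / x - 1)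
    have h2 : 2 * log 2 ≤ (1 / x - 1) * (2 * log 2 / δ) := by
      have := mul_le_mul_of_nonneg_right hlx hnn
      rwa [mul_div_cancel₀ _ hδ.ne'] at this
    nlinarith

end BranchAndBound

namespace BranchAndBound

/-! ### Summation over levels and sizes -/

open MeasureTheory

/-- One term of the binomial expansion of `(z + (1 - z)) ^ i` is at most 1. At `z = 1`, where `log 0
= 0`, the bound needs `s = i`. -/
theorem choose_le_exp {i s : ℕ} (hs : s ≤ i) {z : ℝ} (h0 : 0 < z) (h1 : z ≤ 1)
    (hz : z = 1 → s = i) :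
    (i.choose s : ℝ) ≤ Real.exp (-(s * Real.log z) - (i - s : ℕ) * Real.log (1 - z)) := by
  rcases h1.eq_or_lt with rfl | h1
  · simp [hz rfl]
  · have h2 : z ^ s * (1 - z) ^ (i - s) * i.choose s ≤ 1 := by
      have h3 := add_pow z (1 - z) i
      rw [add_sub_cancel, one_pow] at h3
      refine le_trans ?_ h3.ge
      exact Finset.single_le_sum (f := fun m => z ^ m * (1 - z) ^ (i - m) * (i.choose m : ℝ))
        (fun m _ => mul_nonneg (mul_nonneg (pow_nonneg h0.le _)
          (pow_nonneg (by linarith) _)) (Nat.cast_nonneg _))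
        (Finset.mem_range.2 (Nat.lt_succ_of_le hs))
    have h3 : z ^ s * (1 - z) ^ (i - s) =
        Real.exp (s * Real.log z + (i - s : ℕ) * Real.log (1 - z)) := by
      rw [Real.exp_add, Real.exp_nat_mul, Real.exp_nat_mul, Real.exp_log h0,
        Real.exp_log (by linarith)]
    rw [h3] at h2
    calc (i.choose s : ℝ) = Real.exp (-(s * Real.log z + (i - s : ℕ) * Real.log (1 - z))) *
          (Real.exp (s * Real.log z + (i - s : ℕ) * Real.log (1 - z)) * i.choose s) := by
            rw [← mul_assoc, ← Real.exp_add]; simp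
      _ ≤ Real.exp (-(s * Real.log z + (i - s : ℕ) * Real.log (1 - z))) * 1 :=
          mul_le_mul_of_nonneg_left h2 (Real.exp_pos _).le
      _ = _ := by rw [mul_one]; ring_nf

/-- With `y = s / n` and `i - s = n (1 - x)`, moving to an intermediate `z` in `[y, x]` only raises
the exponent. The change from `x` to `z` is harmless as `log (1 - z) ≤ 0`, and that from `y` to `z`
as `log z + k z ≤ (k + 1) z - 1 ≤ 0`. -/
theorem choose_mul_exp_le {n i s : ℕ} (hn : 0 < n) (hi : i ≤ n) (hs : s ≤ i) {k z : ℝ}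
    (hk : 0 < k) (h0 : 0 < z) (hsz : (s : ℝ) / n ≤ z) (hz : z ≤ ((s + (n - i) : ℕ) : ℝ) / n)
    (hc : z = (s : ℝ) / n ∨ (k + 1) * z ≤ 1) :
    (i.choose s : ℝ) * Real.exp (-(n * (k * ((s : ℝ) / n) ^ 2 / 2))) ≤ Real.exp (psi k z) ^ n := by
  have hn' : (0 : ℝ) < n := by exact_mod_cast hn
  set x : ℝ := ((s + (n - i) : ℕ) : ℝ) / n with hx
  set y : ℝ := (s : ℝ) / n with hy
  have hny : (s : ℝ) = n * y := by rw [hy]; field_simp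
  have hnx : ((s + (n - i) : ℕ) : ℝ) = n * x := by rw [hx]; field_simp
  have his : ((i - s : ℕ) : ℝ) = n * (1 - x) := by
    have : ((i - s : ℕ) : ℝ) + (s + (n - i) : ℕ) = n := by norm_cast; omega
    linarith
  have hx1 : x ≤ 1 := by
    have : (0 : ℝ) ≤ n * (1 - x) := by rw [← his]; positivity
    nlinarith
  have hz1 : z ≤ 1 := hz.trans hx1
  have hzi : z = 1 → s = i := by
    intro h
    have hx' : x = 1 := by linarith
    rw [hx', sub_self, mul_zero, Nat.cast_eq_zero] at his
    omega
  refine (mul_le_mul_of_nonneg_right (choose_le_exp hs h0 hz1 hzi) (Real.exp_pos _).le).trans ?_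
  rw [← Real.exp_add, ← Real.exp_nat_mul]
  apply Real.exp_le_exp.2
  rw [his, hny, psi]
  have h1 : (x - z) * Real.log (1 - z) ≤ 0 :=
    mul_nonpos_of_nonneg_of_nonpos (by linarith)
      (Real.log_nonpos (by linarith) (by linarith))
  have h2 : (z - y) * (Real.log z + k * (z + y) / 2) ≤ 0 := by
    rcases hc with rfl | hc
    · simp
    · refine mul_nonpos_of_nonneg_of_nonpos (by linarith) ?_
      have := Real.log_le_sub_one_of_pos h0
      have : k * y ≤ k * z := mul_le_mul_of_nonneg_left hsz hk.le
      linarith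
  have h3 : -(y * Real.log z) - (1 - x) * Real.log (1 - z) - k * y ^ 2 / 2 ≤
      -z * Real.log z - (1 - z) * Real.log (1 - z) - k * z ^ 2 / 2 := by
    linarith
  have h4 := mul_le_mul_of_nonneg_left h3 hn'.le
  linarith

theorem one_sub_pow_choose_le (p : unitInterval) (s : ℕ) :
    (1 - p : ℝ) ^ s.choose 2 ≤ Real.exp (-(p * (s * (s - 1)) / 2)) := by
  have h : (1 - p : ℝ) ≤ Real.exp (-p) := by
    have := Real.add_one_le_exp (-(p : ℝ))
    linarith
  refine (pow_le_pow_left₀ (sub_nonneg.2 p.2.2) h _).trans (le_of_eq ?_)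
  rw [← Real.exp_nat_mul, Nat.cast_choose_two]
  ring_nf

/-- The contribution of the nodes of level `i` with a partial solution of size `s` to the bound for
the average running time. -/
theorem choose_mul_min_le {n i s : ℕ} (hn : 0 < n) (hi : i ≤ n) (hs : s ≤ i) {k : ℝ} (hk : 0 < k)
    {p : unitInterval} (hp : (p : ℝ) = k / n) :
    (i.choose s : ℝ) * min ((1 - p : ℝ) ^ s.choose 2)
      ((SimpleGraph.binomialRandom (Fin n) p).real {G | IndepBound G (s + (n - i))}) ≤
      2 * n * gamma k ^ n := by
  have hn' : (0 : ℝ) < n := by exact_mod_cast hn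
  have hn1 : (1 : ℝ) ≤ n := by exact_mod_cast hn
  have hγ := one_le_gamma hk
  have hγn : 1 ≤ gamma k ^ n := one_le_pow₀ hγ
  have hC : (0 : ℝ) ≤ i.choose s := Nat.cast_nonneg _
  rcases Nat.eq_zero_or_pos (s + (n - i)) with hb | hb
  · have : {G : SimpleGraph (Fin n) | IndepBound G (s + (n - i))} = ∅ := by
      refine Set.eq_empty_of_forall_notMem fun G hG => ?_
      have := hG {⟨0, hn⟩} (by simp [SimpleGraph.IsIndepSet])
      rw [hb] at this
      simp at this
    rw [this, measureReal_empty, min_eq_right (pow_nonneg (sub_nonneg.2 p.2.2) _), mul_zero]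
    positivity
  -- If `p (s - 1) ≥ 2 log n`, then `n ^ s` sets contribute at most 1 in total. Otherwise replacing
  -- `s (s - 1)` by `s²` costs only `exp (p s / 2) ≤ exp (1 / 2) * n ≤ 2 n`, uniformly in `k`.
  rcases le_or_gt (2 * Real.log n) (p * (s - 1)) with hlarge | hsmall
  · have h1 : (i.choose s : ℝ) * (1 - p : ℝ) ^ s.choose 2 ≤ 1 := by
      have h2 : (i.choose s : ℝ) ≤ Real.exp (s * Real.log n) := by
        rw [Real.exp_nat_mul, Real.exp_log hn']
        exact_mod_cast (Nat.choose_le_pow i s).trans (Nat.pow_le_pow_left hi s)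
      refine (mul_le_mul h2 (one_sub_pow_choose_le p s)
        (pow_nonneg (sub_nonneg.2 p.2.2) _) (Real.exp_pos _).le).trans ?_
      rw [← Real.exp_add]
      refine Real.exp_le_one_iff.2 ?_
      have := mul_le_mul_of_nonneg_left hlarge (Nat.cast_nonneg (α := ℝ) s)
      linarith
    refine (mul_le_mul_of_nonneg_left (min_le_left _ _) hC).trans (h1.trans ?_)
    nlinarith
  have hexp : (1 - p : ℝ) ^ s.choose 2 ≤
      2 * n * Real.exp (-(n * (k * ((s : ℝ) / n) ^ 2 / 2))) := by
    refine (one_sub_pow_choose_le p s).trans ?_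
    have h1 : n * (k * ((s : ℝ) / n) ^ 2 / 2) = p * s ^ 2 / 2 := by
      rw [hp]
      field_simp
    have h2 : Real.exp (1 / 2) ≤ 2 := by
      have h3 := Real.add_one_le_exp (-(1 / 2 : ℝ))
      rw [Real.exp_neg] at h3
      have h4 := Real.exp_pos (1 / 2)
      rw [← inv_inv (Real.exp (1 / 2))]
      exact inv_le_of_inv_le₀ two_pos (by linarith)
    rw [h1]
    calc _ ≤ Real.exp (1 / 2 + Real.log n + -(p * s ^ 2 / 2)) := by
          apply Real.exp_le_exp.2
          have := p.2.2
          linarith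
      _ = Real.exp (1 / 2) * n * Real.exp (-(p * s ^ 2 / 2)) := by
          rw [Real.exp_add, Real.exp_add, Real.exp_log hn']
      _ ≤ _ := by gcongr
  have hbound : ∀ z : ℝ, 0 < z → (s : ℝ) / n ≤ z → z ≤ ((s + (n - i) : ℕ) : ℝ) / n →
      (z = (s : ℝ) / n ∨ (k + 1) * z ≤ 1) →
      (i.choose s : ℝ) * min ((1 - p : ℝ) ^ s.choose 2)
      ((SimpleGraph.binomialRandom (Fin n) p).real {G | IndepBound G (s + (n - i))}) ≤
      2 * n * Real.exp (psi k z) ^ n := by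
    intro z h0 hsz hz hc
    have h1 := choose_mul_exp_le hn hi hs hk h0 hsz hz hc
    calc _ ≤ (i.choose s : ℝ) * (2 * n * Real.exp (-(n * (k * ((s : ℝ) / n) ^ 2 / 2)))) :=
          mul_le_mul_of_nonneg_left ((min_le_left _ _).trans hexp) hC
      _ = 2 * n * ((i.choose s : ℝ) * Real.exp (-(n * (k * ((s : ℝ) / n) ^ 2 / 2)))) := by ring
      _ ≤ _ := mul_le_mul_of_nonneg_left h1 (by positivity)
  set x : ℝ := ((s + (n - i) : ℕ) : ℝ) / n with hx
  have hx0 : 0 < x := div_pos (by exact_mod_cast hb) hn'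
  have hx1 : x ≤ 1 := by
    rw [hx, div_le_one hn']
    exact_mod_cast (by omega : s + (n - i) ≤ n)
  have hsx : (s : ℝ) / n ≤ x := by
    rw [hx]
    gcongr
    omega
  rcases le_or_gt (1 / x) (k + 1) with hkx | hkx
  · have hkx' : 1 / (k + 1) ≤ x := by
      rw [div_le_iff₀ hx0] at hkx
      rw [div_le_iff₀ (by linarith)]
      linarith
    -- This `z` lies between `s / n` and `x` and satisfies `1 / z ≤ k + 1`, where the minimum
    -- defining γ is ψ.
    have hz0 : 0 < max ((s : ℝ) / n) (1 / (k + 1)) := lt_max_of_lt_right (by positivity)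
    refine (hbound (max ((s : ℝ) / n) (1 / (k + 1))) hz0 (le_max_left _ _)
      (max_le hsx hkx') ?_).trans ?_
    · rcases max_choice ((s : ℝ) / n) (1 / (k + 1)) with h | h <;> rw [h]
      · exact Or.inl rfl
      · right
        rw [mul_one_div_cancel (by linarith)]
    · gcongr
      refine exp_psi_le_gamma hk ⟨hz0, (max_le hsx hkx').trans hx1⟩ ?_
      rw [div_le_iff₀ hz0, ← div_le_iff₀' (by linarith)]
      exact le_max_right _ _
  · have hx2 : (k + 1) * x ≤ 1 := ((lt_div_iff₀ hx0).1 hkx).le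
    have h1 := hbound x hx0 hsx le_rfl (Or.inr hx2)
    have h2 : (i.choose s : ℝ) * min ((1 - p : ℝ) ^ s.choose 2)
        ((SimpleGraph.binomialRandom (Fin n) p).real {G | IndepBound G (s + (n - i))}) ≤
        2 * n * Real.exp (mu k (1 / x) / 2) ^ n := by
      have h3 : (i.choose s : ℝ) ≤ 2 ^ n := by
        exact_mod_cast (Nat.choose_le_two_pow i s).trans (Nat.pow_le_pow_right two_pos hi)
      have h4 := binomialRandom_real_indepBound_le hk hn hp hb hkx
      rw [← Real.exp_nat_mul]
      refine (mul_le_mul h3 (min_le_right _ _) (le_min (pow_nonneg (sub_nonneg.2 p.2.2) _)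
        measureReal_nonneg) (by positivity)).trans (h4.trans ?_)
      exact le_mul_of_one_le_left (Real.exp_pos _).le (by linarith)
    refine le_trans ?_ (mul_le_mul_of_nonneg_left (pow_le_pow_left₀ (Real.exp_pos _).le
      (exp_min_le_gamma hk ⟨hx0, hx1⟩) n) (by positivity))
    rcases min_choice (psi k x) (mu k (1 / x) / 2) with h | h <;> rw [h]
    · exact h1
    · exact h2

theorem averageRunningTime_le_gamma {k : ℝ} (hk : 0 < k) {n : ℕ} (hn : 0 < n) {p : unitInterval}
    (hp : (p : ℝ) = k / n) :
    averageRunningTime n p ≤ ENNReal.ofReal (8 * (n : ℝ) ^ 3 * gamma k ^ n) := by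
  refine (averageRunningTime_le n p).trans (ENNReal.ofReal_le_ofReal ?_)
  have hn1 : (1 : ℝ) ≤ n := by exact_mod_cast hn
  have hγ : 0 < gamma k := one_pos.trans_le (one_le_gamma hk)
  have hlevel : ∀ i ∈ Finset.range (n + 1), ∑ S ∈ (initial n i).powerset,
      (SimpleGraph.binomialRandom (Fin n) p).real
        {G | G.IsIndepSet (S : Set (Fin n)) ∧ IndepBound G (S.card + (n - i))} ≤
      (n + 1) * (2 * n * gamma k ^ n) := by
    intro i hi
    have hi : i ≤ n := Nat.lt_succ_iff.1 (Finset.mem_range.1 hi)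
    calc _ ≤ ∑ S ∈ (initial n i).powerset, min ((1 - p : ℝ) ^ S.card.choose 2)
          ((SimpleGraph.binomialRandom (Fin n) p).real
            {G | IndepBound G (S.card + (n - i))}) := by
          refine Finset.sum_le_sum fun S _ => le_min ?_ (measureReal_mono fun G hG => hG.2)
          exact (measureReal_mono fun G hG => hG.1).trans (binomialRandom_real_isIndepSet_le p S)
      _ = ∑ s ∈ Finset.range (i + 1), (i.choose s : ℝ) * min ((1 - p : ℝ) ^ s.choose 2)
          ((SimpleGraph.binomialRandom (Fin n) p).real {G | IndepBound G (s + (n - i))}) := by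
          rw [Finset.sum_powerset_apply_card (fun s => min ((1 - p : ℝ) ^ s.choose 2)
            ((SimpleGraph.binomialRandom (Fin n) p).real {G | IndepBound G (s + (n - i))})),
            card_initial hi]
          simp only [nsmul_eq_mul]
      _ ≤ ∑ s ∈ Finset.range (i + 1), 2 * n * gamma k ^ n := by
          refine Finset.sum_le_sum fun s hs => ?_
          exact choose_mul_min_le hn hi (Nat.lt_succ_iff.1 (Finset.mem_range.1 hs)) hk hp
      _ ≤ _ := by
          rw [Finset.sum_const, Finset.card_range, nsmul_eq_mul]
          gcongr
          exact_mod_cast Nat.succ_le_succ hi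
  refine (Finset.sum_le_sum hlevel).trans ?_
  rw [Finset.sum_const, Finset.card_range, nsmul_eq_mul]
  push_cast
  calc ((n : ℝ) + 1) * ((n + 1) * (2 * n * gamma k ^ n))
      ≤ (n + n) * ((n + n) * (2 * n * gamma k ^ n)) := by gcongr
    _ = _ := by ring

theorem exists_pow_mul_pow_le (d : ℕ) {a b : ℝ} (ha : 0 ≤ a) (hab : a < b) :
    ∃ C : ℝ, ∀ n : ℕ, (n : ℝ) ^ d * a ^ n ≤ C * b ^ n := by
  have hb : 0 < b := ha.trans_lt hab
  have h := tendsto_pow_const_mul_const_pow_of_abs_lt_one d (r := a / b)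
    (by rw [abs_of_nonneg (by positivity), div_lt_one hb]; exact hab)
  obtain ⟨C, hC⟩ := h.bddAbove_range
  refine ⟨C, fun n => ?_⟩
  have h1 := mul_le_mul_of_nonneg_right (hC ⟨n, rfl⟩) (pow_pos hb n).le
  have h2 : (n : ℝ) ^ d * (a / b) ^ n * b ^ n = n ^ d * a ^ n := by
    rw [mul_assoc, ← mul_pow, div_mul_cancel₀ _ hb.ne']
  exact h2.symm.trans_le h1

end BranchAndBound

theorem theorem4 :
    -- the average running time for `p = k / n` is at most `γ(k) ^ n`, up to a polynomial factor
    (∃ (C : ℝ) (d : ℕ), ∀ k : ℝ, 0 < k → ∀ n : ℕ, 0 < n → ∀ p : unitInterval, (p : ℝ) = k / n →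
      BranchAndBound.averageRunningTime n p
        ≤ ENNReal.ofReal (C * (n : ℝ) ^ d * BranchAndBound.gamma k ^ n)) ∧
    -- it is `O(1.867 ^ n)`
    (∃ C : ℝ, ∀ k : ℝ, 0 < k → ∀ n : ℕ, 0 < n → ∀ p : unitInterval, (p : ℝ) = k / n →
      BranchAndBound.averageRunningTime n p ≤ ENNReal.ofReal (C * (1.867 : ℝ) ^ n)) ∧
    -- up to an error of `0.001`, the largest value of `γ` is `γ(0.47)`
    (∀ k : ℝ, 0 < k → BranchAndBound.gamma k ≤ BranchAndBound.gamma 0.47 + 0.001) ∧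
    BranchAndBound.gamma 0.47 ≤ 1.867 ∧
    (∀ k : ℝ, 0 < k → BranchAndBound.gamma k ≤ 1.867) ∧
    Filter.Tendsto BranchAndBound.gamma (nhdsWithin 0 (Set.Ioi 0)) (nhds 1) ∧
    Filter.Tendsto BranchAndBound.gamma Filter.atTop (nhds 1) := by
  refine ⟨⟨8, 3, fun k hk n hn p hp => BranchAndBound.averageRunningTime_le_gamma hk hn hp⟩, ?_,
    fun k hk => ?_, (BranchAndBound.gamma_le_base (by norm_num)).trans (by norm_num),
    fun k hk => (BranchAndBound.gamma_le_base hk).trans (by norm_num),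
    BranchAndBound.tendsto_gamma_zero, BranchAndBound.tendsto_gamma_atTop⟩
  -- The gap between 1.8668 and 1.867 absorbs the factor `n ^ 3`.
  · obtain ⟨C, hC⟩ := BranchAndBound.exists_pow_mul_pow_le 3 (a := 1.8668) (b := 1.867)
      (by norm_num) (by norm_num)
    refine ⟨8 * C, fun k hk n hn p hp =>
      (BranchAndBound.averageRunningTime_le_gamma hk hn hp).trans (ENNReal.ofReal_le_ofReal ?_)⟩
    have hγ : 0 ≤ BranchAndBound.gamma k := zero_le_one.trans (BranchAndBound.one_le_gamma hk)
    have h1 : (n : ℝ) ^ 3 * BranchAndBound.gamma k ^ n ≤ (n : ℝ) ^ 3 * 1.8668 ^ n := by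
      gcongr
      exact BranchAndBound.gamma_le_base hk
    linarith [hC n]
  · have h1 := BranchAndBound.gamma_le_base hk
    have h2 := BranchAndBound.le_gamma_special
    norm_num at h1 h2 ⊢
    linarith
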